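/- Theorem. Let $G$ and $K$ be Lie groups, $M$ a smooth $n$-manifold, $\pi_P : P \to M$ a smooth principal $G$-bundle and $\pi_Q : Q \to M$ a smooth principal $K$-bundle (with right actions). Let $\rho : G \to \mathrm{GL}(n)$ be a smooth representation on $\mathbb{R}^n$ and let $\alpha$ be a solder form on $P$ for $\rho$: a smooth $\mathbb{R}^n$-valued $1$-form on $P$ whose kernel is the vertical tangent bundle, $\ker \alpha_p = \ker (\mathrm{d}\pi_P)_p$ for all $p \in P$, and which is $G$-equivariant, $R_g^*\alpha = \rho(g)^{-1}\alpha$ for all $g \in G$, where $R_g(p) = p\cdot g$. Let $P\times_M Q = \{(p,q) \in P\times Q \mid \pi_P(p) = \pi_Q(q)\}$ be the fibre product, with projection $\phi_P : P\times_M Q \to P$, $(p,q) \mapsto p$, with the map $P\times_M Q\to M$, $(p,q) \mapsto \pi_P(p) = \pi_Q(q)$, and with the right action $(p,q)\cdot(g,k) = (p\cdot g, q\cdot k)$ of $G \times K$. Then $P\times_M Q$ is a smooth manifold embedded in $P \times Q$, the map $P\times_M Q \to M$ is a smooth principal $G\times K$-bundle, and the pullback $\phi_P^*\alpha$ is a solder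 form on $P \times_M Q \to M$ for the smooth representation $G\times K \xrightarrow{p_G} G \xrightarrow{\rho} \mathrm{GL}(n)$, where $p_G$ is the projection to $G$. -/

import Mathlib

open scoped Manifold ContDiff
open Topology

section SolderForms

variable {n : ℕ}
  {EM : Type*} [NormedAddCommGroup EM] [NormedSpace ℝ EM] {HM : Type*} [TopologicalSpace HM]
  {EP : Type*} [NormedAddCommGroup EP] [NormedSpace ℝ EP] {HP : Type*} [TopologicalSpace HP]
  {EQ : Type*} [NormedAddCommGroup EQ] [NormedSpace ℝ EQ] {HQ : Type*} [TopologicalSpace HQ]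
  {EG : Type*} [NormedAddCommGroup EG] [NormedSpace ℝ EG] {HG : Type*} [TopologicalSpace HG]
  {EK : Type*} [NormedAddCommGroup EK] [NormedSpace ℝ EK] {HK : Type*} [TopologicalSpace HK]
  {IM : ModelWithCorners ℝ EM HM} {IP : ModelWithCorners ℝ EP HP} {IQ : ModelWithCorners ℝ EQ HQ}
  {IG : ModelWithCorners ℝ EG HG} {IK : ModelWithCorners ℝ EK HK}
  {M : Type*} [TopologicalSpace M] [ChartedSpace HM M]
  {P : Type*} [TopologicalSpace P] [ChartedSpace HP P]
  {Q : Type*} [TopologicalSpace Q] [ChartedSpace HQ Q]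
  {G : Type*} [TopologicalSpace G] [ChartedSpace HG G] [Group G]
  {K : Type*} [TopologicalSpace K] [ChartedSpace HK K] [Group K]

/-- `π : P → M` together with `act : P → G → P`, `(p, g) ↦ p · g`, is a smooth principal
`G`-bundle: `act` is a smooth right action preserving the fibres of the smooth map `π`, and `M` is
covered by open sets `U` with a diffeomorphism `π⁻¹(U) ≃ U × G` over `U` that is equivariant for
right translation on the factor `G`. -/
structure IsPrincipalBundle (IM : ModelWithCorners ℝ EM HM) (IP : ModelWithCorners ℝ EP HP)
    (IG : ModelWithCorners ℝ EG HG) (π : P → M) (act : P → G → P) : Prop where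
  act_one : ∀ p, act p 1 = p
  act_mul : ∀ p g h, act p (g * h) = act (act p g) h
  proj_act : ∀ p g, π (act p g) = π p
  contMDiff_proj : ContMDiff IP IM ∞ π
  contMDiff_act : ContMDiff (IP.prod IG) IP ∞ (fun x : P × G => act x.1 x.2)
  exists_trivialization : ∀ m : M, ∃ e : Bundle.Trivialization G π, m ∈ e.baseSet ∧
    ContMDiffOn IP (IM.prod IG) ∞ e e.source ∧
    ContMDiffOn (IM.prod IG) IP ∞ e.toOpenPartialHomeomorph.symm e.target ∧
    ∀ p g, π p ∈ e.baseSet → (e (act p g)).2 = (e p).2 * g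

/-- The general linear group of `ℝⁿ`, with Mathlib's Lie group structure on the units of a
complete normed algebra. -/
abbrev GLn (n : ℕ) : Type :=
  (EuclideanSpace ℝ (Fin n) →L[ℝ] EuclideanSpace ℝ (Fin n))ˣ

/-- Smoothness of an `ℝⁿ`-valued `1`-form `α` on `P` (a family of linear maps `α_p : T_pP → ℝⁿ`):
it is smooth as a map `TP → ℝⁿ`. -/
def IsSmoothForm (IP : ModelWithCorners ℝ EP HP) [IsManifold IP ∞ P]
    (α : (p : P) → TangentSpace IP p →L[ℝ] EuclideanSpace ℝ (Fin n)) : Prop :=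
  ContMDiff IP.tangent 𝓘(ℝ, EuclideanSpace ℝ (Fin n)) ∞
    (fun v : TangentBundle IP P => α v.proj v.snd)

/-- The pullback `f^*α` of an `ℝⁿ`-valued `1`-form: `(f^*α)_q(v) = α_{f(q)}(df_q(v))`. -/
noncomputable def pullbackForm (IQ : ModelWithCorners ℝ EQ HQ) (IP : ModelWithCorners ℝ EP HP)
    (f : Q → P) (α : (p : P) → TangentSpace IP p →L[ℝ] EuclideanSpace ℝ (Fin n)) :
    (q : Q) → TangentSpace IQ q →L[ℝ] EuclideanSpace ℝ (Fin n) :=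
  fun q => (α (f q)).comp (mfderiv IQ IP f q)

/-- `α` is a solder form on the principal bundle `π : P → M` with right action `act`, for the
representation `ρ : G → GL(n)`: a smooth `ℝⁿ`-valued `1`-form whose kernel is the vertical tangent
bundle `ker dπ` and which is equivariant, `R_g^*α = ρ(g)⁻¹ ∘ α`. -/
structure IsSolderForm (IM : ModelWithCorners ℝ EM HM) (IP : ModelWithCorners ℝ EP HP)
    [IsManifold IP ∞ P] (π : P → M) (act : P → G → P) (ρ : G →* GLn n)
    (α : (p : P) → TangentSpace IP p →L[ℝ] EuclideanSpace ℝ (Fin n)) : Prop where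
  smooth : IsSmoothForm IP α
  ker_eq_vertical : ∀ (p : P) (v : TangentSpace IP p), α p v = 0 ↔ mfderiv IP IM π p v = 0
  equivariant : ∀ (g : G) (p : P) (v : TangentSpace IP p),
    pullbackForm IP IP (fun x => act x g) α p v =
      ((ρ g)⁻¹ : GLn n).val (α p v)

/-- The fibre product `P ×_M Q = {(p, q) | π_P(p) = π_Q(q)}` of the total spaces of two principal
bundles. -/
@[ext]
structure FiberProduct {πP : P → M} {actP : P → G → P} {πQ : Q → M} {actQ : Q → K → Q}
    (hP : IsPrincipalBundle IM IP IG πP actP) (hQ : IsPrincipalBundle IM IQ IK πQ actQ) where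
  /-- The projection `φ_P : P ×_M Q → P`. -/
  fst : P
  /-- The projection `φ_Q : P ×_M Q → Q`. -/
  snd : Q
  proj_eq : πP fst = πQ snd

namespace FiberProduct

variable {πP : P → M} {actP : P → G → P} {πQ : Q → M} {actQ : Q → K → Q}
  {hP : IsPrincipalBundle IM IP IG πP actP} {hQ : IsPrincipalBundle IM IQ IK πQ actQ}

/-- The inclusion `P ×_M Q → P × Q`. -/
def incl (x : FiberProduct hP hQ) : P × Q := (x.fst, x.snd)

/-- The projection `P ×_M Q → M`. -/
def proj (x : FiberProduct hP hQ) : M := πP x.fst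

/-- The right action of `G × K` on `P ×_M Q`: `(p, q) · (g, k) = (p · g, q · k)`. -/
def act (x : FiberProduct hP hQ) (a : G × K) : FiberProduct hP hQ :=
  ⟨actP x.fst a.1, actQ x.snd a.2, by rw [hP.proj_act, hQ.proj_act, x.proj_eq]⟩

/-- `P ×_M Q` carries the subspace topology of `P × Q`. -/
instance : TopologicalSpace (FiberProduct hP hQ) := TopologicalSpace.induced incl inferInstance

lemma isInducing_incl : IsInducing (incl : FiberProduct hP hQ → P × Q) := ⟨rfl⟩

lemma continuous_fst : Continuous (fst : FiberProduct hP hQ → P) :=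
  _root_.continuous_fst.comp isInducing_incl.continuous

lemma continuous_snd : Continuous (snd : FiberProduct hP hQ → Q) :=
  _root_.continuous_snd.comp isInducing_incl.continuous

open Classical in
/-- The inverse `(p, k) ↦ (p, e⁻¹(π_P(p), k))` of the local trivialization `triv` below, extended by
the value `x₀` outside its domain. -/
noncomputable def trivInv (e : Bundle.Trivialization K πQ) (x₀ : FiberProduct hP hQ) (y : P × K) :
    FiberProduct hP hQ :=
  if h : πP y.1 ∈ e.baseSet then
    ⟨y.1, e.toOpenPartialHomeomorph.symm (πP y.1, y.2), (e.proj_symm_apply' h).symm⟩ else x₀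

lemma trivInv_fst {e : Bundle.Trivialization K πQ} {x₀ : FiberProduct hP hQ} {y : P × K}
    (h : πP y.1 ∈ e.baseSet) : (trivInv e x₀ y).fst = y.1 := by
  simp [trivInv, h]

lemma trivInv_snd {e : Bundle.Trivialization K πQ} {x₀ : FiberProduct hP hQ} {y : P × K}
    (h : πP y.1 ∈ e.baseSet) :
    (trivInv e x₀ y).snd = e.toOpenPartialHomeomorph.symm (πP y.1, y.2) := by
  simp [trivInv, h]

lemma snd_mem_source {e : Bundle.Trivialization K πQ} {x : FiberProduct hP hQ}
    (h : πP x.fst ∈ e.baseSet) : x.snd ∈ e.source :=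
  e.mem_source.2 (x.proj_eq ▸ h)

/-- A local trivialization `e` of `Q` over `U ⊆ M` induces the local trivialization
`(p, q) ↦ (p, pr₂ (e q))` of `P ×_M Q` over `π_P⁻¹(U)`. -/
noncomputable def triv (e : Bundle.Trivialization K πQ) (x₀ : FiberProduct hP hQ) :
    OpenPartialHomeomorph (FiberProduct hP hQ) (P × K) where
  toFun x := (x.fst, (e x.snd).2)
  invFun := trivInv e x₀
  source := (fun x => πP x.fst) ⁻¹' e.baseSet
  target := (fun y => πP y.1) ⁻¹' e.baseSet
  map_source' _ hx := hx
  map_target' y hy := by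
    have hy' : πP y.1 ∈ e.baseSet := hy
    simpa [trivInv_fst hy'] using hy'
  left_inv' x hx := by
    have hx' : πP x.fst ∈ e.baseSet := hx
    refine FiberProduct.ext (trivInv_fst hx') ?_
    rw [trivInv_snd hx']
    simp only [x.proj_eq]
    exact e.symm_apply_mk_proj (snd_mem_source hx')
  right_inv' y hy := by
    have hy' : πP y.1 ∈ e.baseSet := hy
    refine Prod.ext (trivInv_fst hy') ?_
    simp only [trivInv_snd hy', e.apply_symm_apply' hy']
  open_source := e.open_baseSet.preimage (hP.contMDiff_proj.continuous.comp continuous_fst)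
  open_target := e.open_baseSet.preimage (hP.contMDiff_proj.continuous.comp _root_.continuous_fst)
  continuousOn_toFun :=
    continuous_fst.continuousOn.prodMk (_root_.continuous_snd.comp_continuousOn
      (e.continuousOn_toFun.comp continuous_snd.continuousOn fun _ hx => snd_mem_source hx))
  continuousOn_invFun := by
    rw [isInducing_incl.continuousOn_iff]
    have hc : ContinuousOn (fun y : P × K =>
        (y.1, e.toOpenPartialHomeomorph.symm (πP y.1, y.2)))
        ((fun y => πP y.1) ⁻¹' e.baseSet) := by
      refine _root_.continuous_fst.continuousOn.prodMk ?_
      refine e.toOpenPartialHomeomorph.continuousOn_symm.comp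
        ((hP.contMDiff_proj.continuous.comp _root_.continuous_fst).prodMk
          _root_.continuous_snd).continuousOn ?_
      intro y hy
      exact e.mem_target.2 hy
    exact hc.congr fun y hy => Prod.ext (trivInv_fst hy) (trivInv_snd hy)

/-- A chosen smooth local trivialization of `Q` near `m`. -/
noncomputable def trivQ {πQ : Q → M} {actQ : Q → K → Q}
    (hQ : IsPrincipalBundle IM IQ IK πQ actQ) (m : M) : Bundle.Trivialization K πQ :=
  (hQ.exists_trivialization m).choose

/-- The local trivialization of `P ×_M Q` near `x` induced by the chosen one of `Q`. -/
noncomputable def trivAt (x : FiberProduct hP hQ) :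
    OpenPartialHomeomorph (FiberProduct hP hQ) (P × K) :=
  triv (trivQ hQ x.proj) x

/-- The chart of `P ×_M Q` around `x`: the local trivialization near `x`, followed by a product
chart of `P × K`. -/
noncomputable def chart (x : FiberProduct hP hQ) :
    OpenPartialHomeomorph (FiberProduct hP hQ) (ModelProd HP HK) :=
  (trivAt x).trans (chartAt (ModelProd HP HK) (trivAt x x))

/-- The manifold structure of `P ×_M Q`. -/
noncomputable instance : ChartedSpace (ModelProd HP HK) (FiberProduct hP hQ) where
  atlas := Set.range chart
  chartAt := chart
  mem_chart_source x := by
    rw [chart, OpenPartialHomeomorph.trans_source]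
    exact ⟨(hQ.exists_trivialization x.proj).choose_spec.1,
      mem_chart_source (ModelProd HP HK) (trivAt x x)⟩
  chart_mem_atlas x := ⟨x, rfl⟩

lemma contMDiffOn_transition (x y : FiberProduct hP hQ) :
    ContMDiffOn (IP.prod IK) (IP.prod IK) ∞ (trivAt y ∘ (trivAt x).symm)
      ((trivAt x).symm.trans (trivAt y)).source := by
  obtain ⟨-, -, hx, -⟩ := (hQ.exists_trivialization x.proj).choose_spec
  obtain ⟨-, hy, -, -⟩ := (hQ.exists_trivialization y.proj).choose_spec
  change ContMDiffOn _ _ _ (trivQ hQ x.proj).toOpenPartialHomeomorph.symm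
    (trivQ hQ x.proj).target at hx
  change ContMDiffOn _ _ _ (trivQ hQ y.proj) (trivQ hQ y.proj).source at hy
  rw [trivAt, trivAt]
  generalize trivQ hQ x.proj = e at hx ⊢
  generalize trivQ hQ y.proj = e' at hy ⊢
  have hs : ∀ z ∈ ((triv e x).symm.trans (triv e' y)).source,
      πP z.1 ∈ e.baseSet ∧ πP z.1 ∈ e'.baseSet := by
    rintro z ⟨hz1, hz2⟩
    have hz1' : πP z.1 ∈ e.baseSet := hz1
    have h : πP (trivInv e x z).fst ∈ e'.baseSet := hz2
    rw [trivInv_fst hz1'] at h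
    exact ⟨hz1', h⟩
  have hc : ContMDiffOn (IP.prod IK) (IP.prod IK) ∞
      (fun z : P × K => (z.1, (e' (e.toOpenPartialHomeomorph.symm (πP z.1, z.2))).2))
      ((triv e x).symm.trans (triv e' y)).source := by
    refine contMDiff_fst.contMDiffOn.prodMk ?_
    refine contMDiff_snd.comp_contMDiffOn (hy.comp (hx.comp
      (((hP.contMDiff_proj.comp contMDiff_fst).prodMk contMDiff_snd).contMDiffOn) ?_) ?_)
    · intro z hz
      exact e.mem_target.2 (hs z hz).1
    · intro z hz
      refine e'.mem_source.2 ?_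
      change πQ (e.toOpenPartialHomeomorph.symm (πP z.1, z.2)) ∈ e'.baseSet
      rw [e.proj_symm_apply' (hs z hz).1]
      exact (hs z hz).2
  refine hc.congr fun z hz => ?_
  exact Prod.ext (trivInv_fst (hs z hz).1) (congrArg (fun q => (e' q).2) (trivInv_snd (hs z hz).1))

lemma contDiffOn_of_contMDiffOn_model {f : HM → HM} {s : Set HM} (h : ContMDiffOn IM IM ∞ f s) :
    ContDiffOn ℝ ∞ (IM ∘ f ∘ IM.symm) (IM.symm ⁻¹' s ∩ Set.range IM) := by
  intro z hz
  have h' := (contMDiffOn_iff.1 h).2 (IM.symm z) (IM.symm z) z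
  obtain ⟨hz, w, rfl⟩ := hz
  simp only [mfld_simps, chartAt_self_eq] at h' hz ⊢
  exact (h' hz).mono (by intro t ht; exact ⟨ht.2, ht.1⟩)

instance [IsManifold IP ∞ P] [IsManifold IK ∞ K] :
    IsManifold (IP.prod IK) ∞ (FiberProduct hP hQ) := by
  apply isManifold_of_contDiffOn
  rintro _ _ ⟨x, rfl⟩ ⟨y, rfl⟩
  apply contDiffOn_of_contMDiffOn_model
  refine (contMDiffOn_chart (I := IP.prod IK) (n := ∞) (x := trivAt y y)).comp
    ((contMDiffOn_transition x y).comp ((contMDiffOn_chart_symm (I := IP.prod IK) (n := ∞)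
      (x := trivAt x x)).mono ?_) ?_) ?_
  · rintro z ⟨hz, -⟩
    exact hz.1
  · rintro z ⟨hz, hz'⟩
    exact ⟨hz.2, hz'.1⟩
  · rintro z ⟨hz, hz'⟩
    exact hz'.2

end FiberProduct

end SolderForms

section FiberProductGeometry

variable {n : ℕ}
  {EM : Type*} [NormedAddCommGroup EM] [NormedSpace ℝ EM] {HM : Type*} [TopologicalSpace HM]
  {EP : Type*} [NormedAddCommGroup EP] [NormedSpace ℝ EP] {HP : Type*} [TopologicalSpace HP]
  {EQ : Type*} [NormedAddCommGroup EQ] [NormedSpace ℝ EQ] {HQ : Type*} [TopologicalSpace HQ]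
  {EG : Type*} [NormedAddCommGroup EG] [NormedSpace ℝ EG] {HG : Type*} [TopologicalSpace HG]
  {EK : Type*} [NormedAddCommGroup EK] [NormedSpace ℝ EK] {HK : Type*} [TopologicalSpace HK]
  {EN : Type*} [NormedAddCommGroup EN] [NormedSpace ℝ EN] {HN : Type*} [TopologicalSpace HN]
  {IM : ModelWithCorners ℝ EM HM} {IP : ModelWithCorners ℝ EP HP} {IQ : ModelWithCorners ℝ EQ HQ}
  {IG : ModelWithCorners ℝ EG HG} {IK : ModelWithCorners ℝ EK HK} {IN : ModelWithCorners ℝ EN HN}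
  {M : Type*} [TopologicalSpace M] [ChartedSpace HM M]
  {P : Type*} [TopologicalSpace P] [ChartedSpace HP P]
  {Q : Type*} [TopologicalSpace Q] [ChartedSpace HQ Q]
  {G : Type*} [TopologicalSpace G] [ChartedSpace HG G] [Group G]
  {K : Type*} [TopologicalSpace K] [ChartedSpace HK K] [Group K]
  {N : Type*} [TopologicalSpace N] [ChartedSpace HN N]

/-! The fibre product is the pullback of Q along π_P: a trivialization of Q over U identifies the
part over U with π_P⁻¹(U) × K, and product charts of P × K supply the manifold structure, with no
transversality argument. The key fact is `exists_contMDiffAt_retraction`: near each point, the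
inclusion into P × Q has a smooth left inverse. By the chain rule the inclusion is then an
immersion, and a map into the fibre product is smooth as soon as its two components are
(`contMDiffWithinAt_of_fst_snd`). Smoothness of the action and of the inverse trivializations is
thereby reduced to P and Q separately. The kernel and equivariance conditions for φ_P^*α are the
chain rule applied to `proj = πP ∘ fst` and to φ_P ∘ R_(g,k) = R_g ∘ φ_P. -/

/-- Right translation by a fixed group element is smooth. -/
lemma IsPrincipalBundle.contMDiff_act_right {π : P → M} {act : P → G → P}
    (h : IsPrincipalBundle IM IP IG π act) (g : G) :
    ContMDiff IP IP ∞ (fun p => act p g) :=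
  h.contMDiff_act.comp (contMDiff_id.prodMk contMDiff_const)

namespace FiberProduct

variable {πP : P → M} {actP : P → G → P} {πQ : Q → M} {actQ : Q → K → Q}
  {hP : IsPrincipalBundle IM IP IG πP actP} {hQ : IsPrincipalBundle IM IQ IK πQ actQ}

lemma trivQ_mem (x : FiberProduct hP hQ) : πP x.fst ∈ (trivQ hQ x.proj).baseSet :=
  (hQ.exists_trivialization x.proj).choose_spec.1

lemma contMDiffOn_trivQ (m : M) :
    ContMDiffOn IQ (IM.prod IK) ∞ (trivQ hQ m) (trivQ hQ m).source :=
  (hQ.exists_trivialization m).choose_spec.2.1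

lemma contMDiffOn_trivQ_symm (m : M) :
    ContMDiffOn (IM.prod IK) IQ ∞ (trivQ hQ m).toOpenPartialHomeomorph.symm (trivQ hQ m).target :=
  (hQ.exists_trivialization m).choose_spec.2.2.1

lemma mem_trivAt_source (x : FiberProduct hP hQ) : x ∈ (trivAt x).source :=
  trivQ_mem x

/-! ### The fibre product as an embedded submanifold. -/

section Manifold

variable [IsManifold IP ∞ P] [IsManifold IK ∞ K]

/-- The preferred chart at x is `trivAt x` followed by a product chart of P × K; undoing that
product chart near x recovers `trivAt x` as a composite of smooth maps. -/
lemma contMDiffAt_trivAt (x : FiberProduct hP hQ) :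
    ContMDiffAt (IP.prod IK) (IP.prod IK) ∞ (trivAt x) x := by
  have h1 : ContMDiffAt (IP.prod IK) (IP.prod IK) ∞
      (chartAt (ModelProd HP HK) x) x :=
    contMDiffAt_of_mem_maximalAtlas (IsManifold.chart_mem_maximalAtlas x) (mem_chart_source _ x)
  have h2 : ContMDiffAt (IP.prod IK) (IP.prod IK) ∞
      (chartAt (ModelProd HP HK) (trivAt x x)).symm
      (chartAt (ModelProd HP HK) x x) :=
    contMDiffAt_symm_of_mem_maximalAtlas (IsManifold.chart_mem_maximalAtlas _)
      (mem_chart_target _ (trivAt x x))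
  refine (h2.comp x h1).congr_of_eventuallyEq ?_
  filter_upwards [chart_source_mem_nhds (ModelProd HP HK) x] with y hy
  exact ((chartAt (ModelProd HP HK) (trivAt x x)).left_inv hy.2).symm

lemma contMDiffAt_trivAt_symm (x : FiberProduct hP hQ) :
    ContMDiffAt (IP.prod IK) (IP.prod IK) ∞ (trivAt x).symm (trivAt x x) := by
  have h1 : ContMDiffAt (IP.prod IK) (IP.prod IK) ∞
      (chartAt (ModelProd HP HK) (trivAt x x)) (trivAt x x) :=
    contMDiffAt_of_mem_maximalAtlas (IsManifold.chart_mem_maximalAtlas _) (mem_chart_source _ _)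
  have h2 : ContMDiffAt (IP.prod IK) (IP.prod IK) ∞
      (chartAt (ModelProd HP HK) x).symm
      (chartAt (ModelProd HP HK) (trivAt x x) (trivAt x x)) :=
    contMDiffAt_symm_of_mem_maximalAtlas (IsManifold.chart_mem_maximalAtlas x)
      (mem_chart_target _ x)
  refine (h2.comp _ h1).congr_of_eventuallyEq ?_
  filter_upwards [chart_source_mem_nhds (ModelProd HP HK) (trivAt x x)] with y hy
  exact congrArg (trivAt x).symm ((chartAt (ModelProd HP HK) (trivAt x x)).left_inv hy).symm

lemma contMDiff_fst : ContMDiff (IP.prod IK) IP ∞ (fst : FiberProduct hP hQ → P) := fun x =>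
  (_root_.contMDiff_fst (trivAt x x)).comp x (contMDiffAt_trivAt x)

/-- The point q is recovered from p and its fibre coordinate k as e⁻¹(π_P(p), k), because π_Q(q) =
π_P(p). -/
lemma contMDiff_snd : ContMDiff (IP.prod IK) IQ ∞ (snd : FiberProduct hP hQ → Q) := by
  intro x
  have h1 : ContMDiffAt (IP.prod IK) (IM.prod IK) ∞
      (fun y : FiberProduct hP hQ => (πP (trivAt x y).1, (trivAt x y).2)) x :=
    ((hP.contMDiff_proj _).comp x (contMDiff_fst x)).prodMk
      ((_root_.contMDiff_snd (trivAt x x)).comp x (contMDiffAt_trivAt x))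
  have h2 : ContMDiffAt (IM.prod IK) IQ ∞ (trivQ hQ x.proj).toOpenPartialHomeomorph.symm
      (πP (trivAt x x).1, (trivAt x x).2) :=
    (contMDiffOn_trivQ_symm (hQ := hQ) x.proj).contMDiffAt
      ((trivQ hQ x.proj).open_target.mem_nhds ((trivQ hQ x.proj).mem_target.2 (trivQ_mem x)))
  refine (h2.comp x h1).congr_of_eventuallyEq ?_
  filter_upwards [(trivAt x).open_source.mem_nhds (mem_trivAt_source x)] with y hy
  have hy' : πP y.fst ∈ (trivQ hQ x.proj).baseSet := hy
  conv_lhs => rw [← (trivAt x).left_inv hy]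
  exact trivInv_snd (y := trivAt x y) hy'

lemma contMDiff_incl :
    ContMDiff (IP.prod IK) (IP.prod IQ) ∞ (incl : FiberProduct hP hQ → P × Q) :=
  contMDiff_fst.prodMk contMDiff_snd

/-- The local left inverse of the inclusion `P ×_M Q → P × Q` given by a local trivialization. -/
lemma exists_contMDiffAt_retraction (x : FiberProduct hP hQ) :
    ∃ r : P × Q → FiberProduct hP hQ, ContMDiffAt (IP.prod IQ) (IP.prod IK) ∞ r x.incl ∧
      ∀ᶠ y in 𝓝 x, r y.incl = y := by
  -- The retraction keeps p and the fibre coordinate of q, but moves q into the fibre over π_P(p):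
  -- (p, q) ↦ (p, e⁻¹(π_P(p), pr₂(e q))). On the fibre product q is already there.
  refine ⟨fun z => (trivAt x).symm (z.1, (trivQ hQ x.proj z.2).2), ?_, ?_⟩
  · refine ContMDiffAt.comp x.incl (contMDiffAt_trivAt_symm x) ?_
    refine (_root_.contMDiff_fst _).prodMk
      (ContMDiffAt.comp (I' := IM.prod IK) x.incl (_root_.contMDiff_snd _) ?_)
    refine ContMDiffAt.comp (I' := IQ) x.incl ?_ (_root_.contMDiff_snd _)
    exact (contMDiffOn_trivQ (hQ := hQ) x.proj).contMDiffAt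
      ((trivQ hQ x.proj).open_source.mem_nhds (snd_mem_source (trivQ_mem x)))
  · filter_upwards [(trivAt x).open_source.mem_nhds (mem_trivAt_source x)] with y hy
    exact (trivAt x).left_inv hy

/-- The universal property of the fibre product among smooth manifolds. -/
lemma contMDiffWithinAt_of_fst_snd {f : N → FiberProduct hP hQ} {s : Set N} {z : N}
    (h1 : ContMDiffWithinAt IN IP ∞ (fun y => (f y).fst) s z)
    (h2 : ContMDiffWithinAt IN IQ ∞ (fun y => (f y).snd) s z) :
    ContMDiffWithinAt IN (IP.prod IK) ∞ f s z := by
  obtain ⟨r, hr, hr'⟩ := exists_contMDiffAt_retraction (f z)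
  have hi : ContMDiffWithinAt IN (IP.prod IQ) ∞ (fun y => (f y).incl) s z := h1.prodMk h2
  -- Continuity, which holds because the topology is induced from P × Q, transports the local
  -- identity r ∘ incl = id along f to points of s near z.
  have hc : ContinuousWithinAt f s z :=
    isInducing_incl.continuousWithinAt_iff.2 hi.continuousWithinAt
  exact (hr.comp_contMDiffWithinAt z hi).congr_of_eventuallyEq
    ((hc.eventually hr').mono fun _ h => h.symm) hr'.self_of_nhds.symm

/-- Differentiating r ∘ incl = id near x gives a left inverse of the differential. -/
lemma mfderiv_incl_injective (x : FiberProduct hP hQ) :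
    Function.Injective (mfderiv (IP.prod IK) (IP.prod IQ) incl x) := by
  obtain ⟨r, hr, hr'⟩ := exists_contMDiffAt_retraction x
  have hi : MDifferentiableAt (IP.prod IK) (IP.prod IQ) (incl : FiberProduct hP hQ → P × Q) x :=
    (contMDiff_incl x).mdifferentiableAt (by simp)
  have hd := mfderiv_comp x (hr.mdifferentiableAt (by simp)) hi
  rw [Filter.EventuallyEq.mfderiv_eq (f₁ := r ∘ incl) (f := id) hr', mfderiv_id] at hd
  intro v w hvw
  have h := congrArg (mfderiv (IP.prod IQ) (IP.prod IK) r x.incl) hvw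
  exact (DFunLike.congr_fun hd v).trans (h.trans (DFunLike.congr_fun hd w).symm)

end Manifold

/-! ### The principal G × K-bundle structure. -/

open Classical in
/-- The local trivialization of `P ×_M Q → M` induced by local trivializations of `P` and `Q`. -/
noncomputable def prodTriv (e : Bundle.Trivialization G πP) (e' : Bundle.Trivialization K πQ)
    (x₀ : FiberProduct hP hQ) :
    Bundle.Trivialization (G × K) (proj : FiberProduct hP hQ → M) where
  toFun x := (x.proj, ((e x.fst).2, (e' x.snd).2))
  invFun y := if h : y.1 ∈ e.baseSet ∩ e'.baseSet then
    ⟨e.toOpenPartialHomeomorph.symm (y.1, y.2.1), e'.toOpenPartialHomeomorph.symm (y.1, y.2.2),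
      by rw [e.proj_symm_apply' h.1, e'.proj_symm_apply' h.2]⟩ else x₀
  source := proj ⁻¹' (e.baseSet ∩ e'.baseSet)
  target := (e.baseSet ∩ e'.baseSet) ×ˢ Set.univ
  baseSet := e.baseSet ∩ e'.baseSet
  map_source' x hx := ⟨hx, trivial⟩
  map_target' y hy := by
    have h := hy.1
    simp only [h, dite_true, Set.mem_preimage, proj]
    rwa [e.proj_symm_apply' h.1]
  left_inv' x hx := by
    have h : x.proj ∈ e.baseSet ∩ e'.baseSet := hx
    simp only [h, dite_true]
    refine FiberProduct.ext (e.symm_apply_mk_proj (e.mem_source.2 h.1)) ?_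
    have hq : x.proj = πQ x.snd := x.proj_eq
    simp only [hq]
    exact e'.symm_apply_mk_proj (e'.mem_source.2 (hq ▸ h.2))
  right_inv' y hy := by
    have h := hy.1
    simp only [h, dite_true, proj, e.apply_symm_apply' h.1, e'.apply_symm_apply' h.2,
      e.proj_symm_apply' h.1]
  open_source := (e.open_baseSet.inter e'.open_baseSet).preimage
    (hP.contMDiff_proj.continuous.comp continuous_fst)
  open_target := (e.open_baseSet.inter e'.open_baseSet).prod isOpen_univ
  open_baseSet := e.open_baseSet.inter e'.open_baseSet
  continuousOn_toFun := by
    refine (hP.contMDiff_proj.continuous.comp continuous_fst).continuousOn.prodMk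
      ((_root_.continuous_snd.comp_continuousOn (e.continuousOn_toFun.comp
        continuous_fst.continuousOn fun x hx => e.mem_source.2 hx.1)).prodMk
      (_root_.continuous_snd.comp_continuousOn (e'.continuousOn_toFun.comp
        continuous_snd.continuousOn fun x hx => snd_mem_source hx.2)))
  continuousOn_invFun := by
    rw [isInducing_incl.continuousOn_iff]
    have hc : ContinuousOn (fun y : M × G × K =>
        (e.toOpenPartialHomeomorph.symm (y.1, y.2.1), e'.toOpenPartialHomeomorph.symm (y.1, y.2.2)))
        ((e.baseSet ∩ e'.baseSet) ×ˢ Set.univ) := by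
      refine (e.toOpenPartialHomeomorph.continuousOn_symm.comp (by fun_prop)
        fun y hy => e.mem_target.2 hy.1.1).prodMk
        (e'.toOpenPartialHomeomorph.continuousOn_symm.comp (by fun_prop)
          fun y hy => e'.mem_target.2 hy.1.2)
    refine hc.congr fun y hy => ?_
    have h := hy.1
    simp only [Function.comp_apply, h, dite_true, incl]
  source_eq := rfl
  target_eq := rfl
  proj_toFun _ _ := rfl

lemma prodTriv_symm_fst {e : Bundle.Trivialization G πP} {e' : Bundle.Trivialization K πQ}
    {x₀ : FiberProduct hP hQ} {y : M × G × K} (h : y.1 ∈ e.baseSet ∩ e'.baseSet) :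
    ((prodTriv e e' x₀).toOpenPartialHomeomorph.symm y).fst =
      e.toOpenPartialHomeomorph.symm (y.1, y.2.1) :=
  congrArg fst (dif_pos h)

lemma prodTriv_symm_snd {e : Bundle.Trivialization G πP} {e' : Bundle.Trivialization K πQ}
    {x₀ : FiberProduct hP hQ} {y : M × G × K} (h : y.1 ∈ e.baseSet ∩ e'.baseSet) :
    ((prodTriv e e' x₀).toOpenPartialHomeomorph.symm y).snd =
      e'.toOpenPartialHomeomorph.symm (y.1, y.2.2) :=
  congrArg snd (dif_pos h)

variable [IsManifold IP ∞ P] [IsManifold IK ∞ K]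

lemma contMDiff_proj : ContMDiff (IP.prod IK) IM ∞ (proj : FiberProduct hP hQ → M) :=
  hP.contMDiff_proj.comp contMDiff_fst

lemma contMDiff_act : ContMDiff ((IP.prod IK).prod (IG.prod IK)) (IP.prod IK) ∞
    (fun x : FiberProduct hP hQ × (G × K) => x.1.act x.2) := fun z =>
  contMDiffWithinAt_of_fst_snd
    (hP.contMDiff_act.comp ((contMDiff_fst.comp _root_.contMDiff_fst).prodMk
      (_root_.contMDiff_fst.comp _root_.contMDiff_snd)) z)
    (hQ.contMDiff_act.comp ((contMDiff_snd.comp _root_.contMDiff_fst).prodMk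
      (_root_.contMDiff_snd.comp _root_.contMDiff_snd)) z)

/-- The fibre product of a principal `G`-bundle and a principal `K`-bundle is a principal
`G × K`-bundle. -/
lemma isPrincipalBundle : IsPrincipalBundle IM (IP.prod IK) (IG.prod IK)
    (proj : FiberProduct hP hQ → M) act where
  act_one x := FiberProduct.ext (hP.act_one _) (hQ.act_one _)
  act_mul x g h := FiberProduct.ext (hP.act_mul _ _ _) (hQ.act_mul _ _ _)
  proj_act x g := hP.proj_act _ _
  contMDiff_proj := contMDiff_proj
  contMDiff_act := contMDiff_act
  exists_trivialization m := by
    obtain ⟨e, hm, he, he_symm, hact⟩ := hP.exists_trivialization m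
    obtain ⟨e', hm', he', he'_symm, hact'⟩ := hQ.exists_trivialization m
    let x₀ : FiberProduct hP hQ :=
      ⟨e.toOpenPartialHomeomorph.symm (m, 1), e'.toOpenPartialHomeomorph.symm (m, 1),
        by rw [e.proj_symm_apply' hm, e'.proj_symm_apply' hm']⟩
    refine ⟨prodTriv e e' x₀, ⟨hm, hm'⟩, ?_, ?_, ?_⟩
    · exact contMDiff_proj.contMDiffOn.prodMk
        ((_root_.contMDiff_snd.comp_contMDiffOn (he.comp contMDiff_fst.contMDiffOn
          fun x hx => e.mem_source.2 hx.1)).prodMk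
        (_root_.contMDiff_snd.comp_contMDiffOn (he'.comp contMDiff_snd.contMDiffOn
          fun x hx => snd_mem_source hx.2)))
    · have h1 : ContMDiffOn (IM.prod (IG.prod IK)) IP ∞
          (fun y : M × G × K => e.toOpenPartialHomeomorph.symm (y.1, y.2.1))
          (prodTriv e e' x₀).target :=
        he_symm.comp (_root_.contMDiff_fst.prodMk
          (_root_.contMDiff_fst.comp _root_.contMDiff_snd)).contMDiffOn
          fun y hy => e.mem_target.2 hy.1.1
      have h2 : ContMDiffOn (IM.prod (IG.prod IK)) IQ ∞
          (fun y : M × G × K => e'.toOpenPartialHomeomorph.symm (y.1, y.2.2))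
          (prodTriv e e' x₀).target :=
        he'_symm.comp (_root_.contMDiff_fst.prodMk
          (_root_.contMDiff_snd.comp _root_.contMDiff_snd)).contMDiffOn
          fun y hy => e'.mem_target.2 hy.1.2
      exact fun z hz => contMDiffWithinAt_of_fst_snd
        (h1.congr (fun y hy => prodTriv_symm_fst hy.1) z hz)
        (h2.congr (fun y hy => prodTriv_symm_snd hy.1) z hz)
    · intro x g hx
      exact Prod.ext (hact _ _ hx.1) (hact' _ _ (x.proj_eq ▸ hx.2))

/-! ### The pulled-back solder form. -/

/-- The pullback of a solder form on `P` to the fibre product is a solder form. -/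
lemma isSolderForm_pullback {ρ : G →* GLn n}
    {α : (p : P) → TangentSpace IP p →L[ℝ] EuclideanSpace ℝ (Fin n)}
    (hα : IsSolderForm IM IP πP actP ρ α) :
    IsSolderForm IM (IP.prod IK) (proj : FiberProduct hP hQ → M) act
      (ρ.comp (MonoidHom.fst G K))
      (pullbackForm (IP.prod IK) IP (fst : FiberProduct hP hQ → P) α) where
  -- As a function on the tangent bundle, φ_P^*α is α composed with the tangent map of φ_P.
  smooth := hα.smooth.comp (contMDiff_fst.contMDiff_tangentMap (by simp))
  ker_eq_vertical x v := by
    have hd : mfderiv (IP.prod IK) IM (proj : FiberProduct hP hQ → M) x =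
        (mfderiv IP IM πP x.fst).comp (mfderiv (IP.prod IK) IP fst x) :=
      mfderiv_comp x ((hP.contMDiff_proj _).mdifferentiableAt (by simp))
        ((contMDiff_fst x).mdifferentiableAt (by simp))
    -- Both sides now depend on v only through dφ_P(v), so the kernel condition on P applies to that
    -- vector.
    rw [hd]
    exact hα.ker_eq_vertical x.fst _
  equivariant g x v := by
    have hact : ContMDiff (IP.prod IK) (IP.prod IK) ∞ (fun y : FiberProduct hP hQ => y.act g) :=
      contMDiff_act.comp (contMDiff_id.prodMk contMDiff_const)
    -- `h1` and `h2` differentiate the two sides of φ_P ∘ R_(g,k) = R_g ∘ φ_P, which agree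
    -- definitionally.
    have h1 := mfderiv_comp x ((contMDiff_fst (x.act g)).mdifferentiableAt (by simp))
      ((hact x).mdifferentiableAt (by simp))
    have h2 := mfderiv_comp x
      ((hP.contMDiff_act_right g.1 x.fst).mdifferentiableAt (by simp))
      ((contMDiff_fst x).mdifferentiableAt (by simp))
    have h3 := DFunLike.congr_fun (h1.symm.trans h2) v
    exact (congrArg (α (x.act g).fst) h3).trans
      (hα.equivariant g.1 x.fst (mfderiv (IP.prod IK) IP fst x v))

end FiberProduct

end FiberProductGeometry

theorem mainTheorem8 {n : ℕ}
    {EM : Type*} [NormedAddCommGroup EM] [NormedSpace ℝ EM] [FiniteDimensional ℝ EM]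
    {HM : Type*} [TopologicalSpace HM] {IM : ModelWithCorners ℝ EM HM}
    {EP : Type*} [NormedAddCommGroup EP] [NormedSpace ℝ EP] [FiniteDimensional ℝ EP]
    {HP : Type*} [TopologicalSpace HP] {IP : ModelWithCorners ℝ EP HP}
    {EQ : Type*} [NormedAddCommGroup EQ] [NormedSpace ℝ EQ] [FiniteDimensional ℝ EQ]
    {HQ : Type*} [TopologicalSpace HQ] {IQ : ModelWithCorners ℝ EQ HQ}
    {EG : Type*} [NormedAddCommGroup EG] [NormedSpace ℝ EG] [FiniteDimensional ℝ EG]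
    {HG : Type*} [TopologicalSpace HG] {IG : ModelWithCorners ℝ EG HG}
    {EK : Type*} [NormedAddCommGroup EK] [NormedSpace ℝ EK] [FiniteDimensional ℝ EK]
    {HK : Type*} [TopologicalSpace HK] {IK : ModelWithCorners ℝ EK HK}
    -- an `n`-manifold `M`, manifolds `P` and `Q`, Lie groups `G` and `K`
    {M : Type*} [TopologicalSpace M] [ChartedSpace HM M] [IsManifold IM ∞ M]
    (hn : Module.finrank ℝ EM = n)
    {P : Type*} [TopologicalSpace P] [ChartedSpace HP P] [IsManifold IP ∞ P]
    {Q : Type*} [TopologicalSpace Q] [ChartedSpace HQ Q] [IsManifold IQ ∞ Q]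
    {G : Type*} [TopologicalSpace G] [ChartedSpace HG G] [Group G] [LieGroup IG ∞ G]
    {K : Type*} [TopologicalSpace K] [ChartedSpace HK K] [Group K] [LieGroup IK ∞ K]
    -- principal bundles `P → M` and `Q → M`
    {πP : P → M} {actP : P → G → P} (hP : IsPrincipalBundle IM IP IG πP actP)
    {πQ : Q → M} {actQ : Q → K → Q} (hQ : IsPrincipalBundle IM IQ IK πQ actQ)
    -- a representation `ρ : G → GL(n)` and a solder form `α` on `P`
    (ρ : G →* GLn n)
    (hρ : ContMDiff IG 𝓘(ℝ, EuclideanSpace ℝ (Fin n) →L[ℝ] EuclideanSpace ℝ (Fin n)) ∞ ρ)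
    (α : (p : P) → TangentSpace IP p →L[ℝ] EuclideanSpace ℝ (Fin n))
    (hα : IsSolderForm IM IP πP actP ρ α) :
    -- `P ×_M Q` is an embedded submanifold of `P × Q`
    (ContMDiff (IP.prod IK) (IP.prod IQ) ∞ (FiberProduct.incl : FiberProduct hP hQ → P × Q) ∧
      IsEmbedding (FiberProduct.incl : FiberProduct hP hQ → P × Q) ∧
      ∀ x : FiberProduct hP hQ,
        Function.Injective (mfderiv (IP.prod IK) (IP.prod IQ) FiberProduct.incl x)) ∧
    -- `P ×_M Q → M` is a principal `G × K`-bundle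
    IsPrincipalBundle IM (IP.prod IK) (IG.prod IK)
      (FiberProduct.proj : FiberProduct hP hQ → M) FiberProduct.act ∧
    -- `G × K → G → GL(n)` is smooth and `φ_P^*α` is a solder form for it
    ContMDiff (IG.prod IK) 𝓘(ℝ, EuclideanSpace ℝ (Fin n) →L[ℝ] EuclideanSpace ℝ (Fin n)) ∞
      (ρ.comp (MonoidHom.fst G K)) ∧
    IsSolderForm IM (IP.prod IK) (FiberProduct.proj : FiberProduct hP hQ → M) FiberProduct.act
      (ρ.comp (MonoidHom.fst G K))
      (pullbackForm (IP.prod IK) IP (FiberProduct.fst : FiberProduct hP hQ → P) α) := by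
  -- The topology is induced by definition, so only injectivity of the inclusion is left to prove.
  refine ⟨⟨FiberProduct.contMDiff_incl, ⟨FiberProduct.isInducing_incl, fun x y h => ?_⟩,
    FiberProduct.mfderiv_incl_injective⟩, FiberProduct.isPrincipalBundle,
    hρ.comp contMDiff_fst, FiberProduct.isSolderForm_pullback hα⟩
  exact FiberProduct.ext (congrArg Prod.fst h) (congrArg Prod.snd h)
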